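/- Let $q$ be an odd prime power. Let $U(n,q)$ be the finite unitary group, that is, the subgroup of $GL(n,\mathbb F_{q^2})$ stabilizing the Hermitian form $\sum_{i=1}^n x_i y_i^{q}$ on $\mathbb F_{q^2}^n$, and let $i_U(n,q)$ be the number of $g\in U(n,q)$ with $g^2=1$ (the identity is counted). Then, with $q$ fixed, both infinite products below converge and: 1. as $n\to\infty$ through the even integers, $$\lim_{n\to\infty}\frac{i_U(n,q)}{q^{n^2/2}}=\prod_{k\ge 1}\frac{(1+q^{2-4k})^2(1-q^{-4k})}{1-(-1/q)^k};$$ 2. as $n\to\infty$ through the odd integers, $$\lim_{n\to\infty}\frac{i_U(n,q)}{q^{(n^2-1)/2}}=2\prod_{k\ge 1}\frac{(1+q^{-4k})^2(1-q^{-4k})}{1-(-1/q)^k}.$$ -/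

import Mathlib

open Filter Topology

section UnitaryInvolutions

/-- The standard Hermitian form `∑ i, x i * (y i) ^ q` on `F ^ n`, where `F` is the field with
`q ^ 2` elements, whose involutory automorphism is `a ↦ a ^ q`. The standard basis is orthonormal
for it. -/
def hermitianForm {n : ℕ} {F : Type*} [Field F] (q : ℕ) (x y : Fin n → F) : F :=
  ∑ i, x i * y i ^ q

/-- The finite (general) unitary group `U(n, q)`: the subgroup of `GL(n, F)`, with `F` the field
with `q ^ 2` elements, that stabilizes the standard Hermitian form. -/
def finiteUnitaryGroup (n q : ℕ) (F : Type*) [Field F] : Subgroup (GL (Fin n) F) where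
  carrier := {g | ∀ x y : Fin n → F,
    hermitianForm q ((g : Matrix (Fin n) (Fin n) F).mulVec x)
      ((g : Matrix (Fin n) (Fin n) F).mulVec y) = hermitianForm q x y}
  one_mem' := by
    intro x y
    simp
  mul_mem' := by
    intro a b ha hb x y
    have h := ha ((b : Matrix (Fin n) (Fin n) F).mulVec x) ((b : Matrix (Fin n) (Fin n) F).mulVec y)
    rw [Matrix.mulVec_mulVec, Matrix.mulVec_mulVec] at h
    rw [Units.val_mul, h, hb x y]
  inv_mem' := by
    intro a ha x y
    have h := ha (((a⁻¹ : GL (Fin n) F) : Matrix (Fin n) (Fin n) F).mulVec x)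
      (((a⁻¹ : GL (Fin n) F) : Matrix (Fin n) (Fin n) F).mulVec y)
    rw [Matrix.mulVec_mulVec, Matrix.mulVec_mulVec, Units.mul_inv, Matrix.one_mulVec,
      Matrix.one_mulVec] at h
    exact h.symm

/-- `i_U(n, q)`: the number of `g` in `U(n, q)` with `g ^ 2 = 1` (the identity is counted). -/
noncomputable def unitaryInvolutionCount (n q : ℕ) (F : Type*) [Field F] : ℕ :=
  Nat.card {g : finiteUnitaryGroup n q F // g ^ 2 = 1}

/-- The factor with index `k ≥ 1` of the product for even `n`. -/
noncomputable def evenFactor (q k : ℕ) : ℝ :=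
  (1 + (q : ℝ) ^ (2 - 4 * (k : ℤ))) ^ 2 * (1 - (q : ℝ) ^ (-4 * (k : ℤ))) /
    (1 - (-1 / (q : ℝ)) ^ k)

/-- The factor with index `k ≥ 1` of the product for odd `n`. -/
noncomputable def oddFactor (q k : ℕ) : ℝ :=
  (1 + (q : ℝ) ^ (-4 * (k : ℤ))) ^ 2 * (1 - (q : ℝ) ^ (-4 * (k : ℤ))) /
    (1 - (-1 / (q : ℝ)) ^ k)

end UnitaryInvolutions

/-!
# Counting the involutions of the finite unitary groups

Write `star a = a ^ q` for the involution of the field `F` with `q ^ 2` elements. Since `q` is odd,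
`g ↦ (1 + g) / 2` identifies the unitary `g` with `g ^ 2 = 1` with the Hermitian idempotent
matrices (`unitaryInvolutionsEquiv`), which are counted rank by rank.

Two double counts suffice, and neither needs the classification of Hermitian spaces or the order of
the unitary group. If `P` is a Hermitian idempotent and `v` is a unit vector in its image, then
`Q = P - v v*` is a Hermitian idempotent of rank one less, and the image of `P` is the orthogonal
sum of the line of `v` and the image of `Q`. Sorting isotropic vectors along this sum gives a
recursion for the number of unit vectors in the image of `P`, whence this number is
`q ^ (r - 1) * (q ^ r - (-1) ^ r)` with `r` the rank (`mul_card_vectorsOfNorm_one`). On the other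
hand `(P, v) ↦ (Q, v)` is a bijection onto the pairs where `v` is a unit vector in the kernel of
`Q`, that is, in the image of `1 - Q`; this compares the numbers of Hermitian idempotents of ranks
`r + 1` and `r` (`card_starProjectionsOfRank_succ`). Hence there are
`q ^ (2 * r * (n - r))` times the Gaussian binomial coefficient of `n` and `r` with parameter
`x = -1 / q` Hermitian idempotents of rank `r` (`card_starProjectionsOfRank`).

For `n = 2 * m + c` with `c = 0` or `1`, put `r = m + c + j` and `t = q ^ (-2)`. The normalized
count is the sum over `j` of `t ^ (j ^ 2 + c * j)` times a Gaussian binomial coefficient. These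
coefficients are bounded and tend to `1 / ∏ (1 - x ^ i)`, so that by Tannery's theorem
(`tendsto_sum_gaussBinom_mul`) the limit is `∑ t ^ (j ^ 2 + c * j)`, over all integers `j`, divided
by `∏ (1 - x ^ i)`. Jacobi's triple product turns the sum into a product. It follows in turn from
the `q`-binomial theorem by the same limit theorem, applied with parameter `t ^ 2`
(`tsum_pow_sq_mul_zpow`).
-/

/-! ### The field with `q ^ 2` elements and its involution -/

lemma finite_of_card_eq_sq {q : ℕ} {F : Type*} (hq : Odd q) (hF : Nat.card F = q ^ 2) :
    Finite F :=
  Nat.finite_of_card_ne_zero (by rw [hF]; exact pow_ne_zero _ hq.pos.ne')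

/-- `a ↦ a ^ q` is a ring involution: `q` divides the order `q ^ 2` of `F`, so it is a power of the
characteristic. -/
lemma exists_starRing_pow {q : ℕ} {F : Type*} [Field F] (hF : Nat.card F = q ^ 2) (hq : Odd q) :
    ∃ _ : StarRing F, ∀ a : F, star a = a ^ q := by
  have := finite_of_card_eq_sq hq hF
  have : Fintype F := Fintype.ofFinite F
  obtain ⟨p, hp⟩ := CharP.exists F
  obtain ⟨k, hpp, hk⟩ := FiniteField.card F p
  have : Fact p.Prime := ⟨hpp⟩
  have hcard : Fintype.card F = q ^ 2 := by rw [← hF, Nat.card_eq_fintype_card]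
  obtain ⟨m, -, hm⟩ := (Nat.dvd_prime_pow hpp).1
    (show q ∣ p ^ (k : ℕ) by rw [← hk, hcard]; exact dvd_pow_self q two_ne_zero)
  refine ⟨{ star := fun a => a ^ q
            star_involutive := fun a => ?_
            star_mul := fun a b => ?_
            star_add := fun a b => ?_ }, fun a => rfl⟩
  · change (a ^ q) ^ q = a
    rw [← pow_mul, ← sq, ← hcard, FiniteField.pow_card]
  · change (a * b) ^ q = b ^ q * a ^ q
    rw [mul_pow, mul_comm]
  · change (a + b) ^ q = a ^ q + b ^ q
    rw [hm, add_pow_char_pow]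

section FrobeniusStar

variable {q : ℕ} {F : Type*} [Field F]

lemma two_ne_zero_of_card_eq (hq : Odd q) (hF : Nat.card F = q ^ 2) : (2 : F) ≠ 0 := by
  have := finite_of_card_eq_sq hq hF
  have : Fintype F := Fintype.ofFinite F
  have hcard : Fintype.card F = q ^ 2 := by rw [← hF, Nat.card_eq_fintype_card]
  have h := Ring.two_ne_zero (R := F) (by
    rw [Ne, FiniteField.even_card_iff_char_two, hcard, ← Nat.even_iff, Nat.not_even_iff_odd]
    exact hq.pow)
  exact h

/-- The nonzero elements fixed by the involution are the norms of the nonzero elements: in the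
cyclic group `Fˣ` of order `q ^ 2 - 1`, both are the unique subgroup of order `q - 1`. -/
lemma range_pow_succ_eq_ker_pow_pred (hq : Odd q) (hF : Nat.card F = q ^ 2) :
    (powMonoidHom (q + 1) : Fˣ →* Fˣ).range = (powMonoidHom (q - 1) : Fˣ →* Fˣ).ker ∧
      Nat.card (powMonoidHom (q - 1) : Fˣ →* Fˣ).ker = q - 1 := by
  have := finite_of_card_eq_sq hq hF
  have hu : Nat.card Fˣ = (q + 1) * (q - 1) := by
    rw [Nat.card_units, hF, ← Nat.sq_sub_sq, one_pow]
  have hker : Nat.card (powMonoidHom (q - 1) : Fˣ →* Fˣ).ker = q - 1 := by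
    rw [IsCyclic.card_powMonoidHom_ker, hu, Nat.gcd_mul_left_left]
  refine ⟨Subgroup.eq_of_le_of_card_ge ?_ ?_, hker⟩
  · rintro _ ⟨a, rfl⟩
    rw [MonoidHom.mem_ker, powMonoidHom_apply, powMonoidHom_apply, ← pow_mul, ← hu,
      pow_card_eq_one']
  · rw [hker, IsCyclic.card_powMonoidHom_range, hu, Nat.gcd_mul_right_left,
      Nat.mul_div_cancel_left _ (Nat.succ_pos q)]

variable [StarRing F]

lemma star_units_eq_iff (hq : Odd q) (hs : ∀ a : F, star a = a ^ q) (u : Fˣ) :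
    star (u : F) = u ↔ u ∈ (powMonoidHom (q - 1) : Fˣ →* Fˣ).ker := by
  rw [MonoidHom.mem_ker, powMonoidHom_apply, hs, ← Units.val_pow_eq_pow_val, Units.val_inj]
  nth_rw 1 [← Nat.sub_add_cancel (Nat.succ_le_of_lt hq.pos), pow_succ]
  exact mul_eq_right

/-- Surjectivity of the norm `a ↦ star a * a` onto the fixed field. -/
lemma exists_star_mul_self_eq (hq : Odd q) (hF : Nat.card F = q ^ 2)
    (hs : ∀ a : F, star a = a ^ q) {c : F} (hc : star c = c) : ∃ a : F, star a * a = c := by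
  rcases eq_or_ne c 0 with rfl | hc0
  · exact ⟨0, by simp⟩
  obtain ⟨u, rfl⟩ := hc0.isUnit
  rw [star_units_eq_iff hq hs, ← (range_pow_succ_eq_ker_pow_pred hq hF).1] at hc
  obtain ⟨a, rfl⟩ := hc
  exact ⟨a, by rw [hs, ← pow_succ]; rfl⟩

lemma card_star_eq_self (hq : Odd q) (hF : Nat.card F = q ^ 2) (hs : ∀ a : F, star a = a ^ q) :
    Nat.card {c : F // star c = c ∧ c ≠ 0} = q - 1 := by
  rw [← (range_pow_succ_eq_ker_pow_pred hq hF).2]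
  exact Nat.card_congr
    { toFun := fun c => ⟨Units.mk0 c.1 c.2.2, (star_units_eq_iff hq hs _).1 c.2.1⟩
      invFun := fun u => ⟨u.1, (star_units_eq_iff hq hs _).2 u.2, u.1.ne_zero⟩
      left_inv := fun c => rfl
      right_inv := fun u => by ext; rfl }

end FrobeniusStar

/-! ### Hermitian idempotent matrices and their images -/

section StarProjection

open Matrix

variable {ι F : Type*} [Fintype ι] [Field F]

/-- The vectors fixed by a square matrix; for an idempotent matrix this is its image. -/
def fixedVectors (P : Matrix ι ι F) : Submodule F (ι → F) :=
  LinearMap.eqLocus P.mulVecLin LinearMap.id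

lemma mem_fixedVectors {P : Matrix ι ι F} {x : ι → F} : x ∈ fixedVectors P ↔ P *ᵥ x = x :=
  Iff.rfl

lemma eq_zero_of_finrank_fixedVectors_eq_zero {P : Matrix ι ι F} (hP : IsIdempotentElem P)
    (h : Module.finrank F (fixedVectors P) = 0) : P = 0 := by
  classical
  rw [Submodule.finrank_eq_zero] at h
  refine Matrix.ext_of_mulVec_single fun i => ?_
  have : P *ᵥ Pi.single i 1 ∈ fixedVectors P := by
    rw [mem_fixedVectors, mulVec_mulVec, hP.eq]
  rw [h, Submodule.mem_bot] at this
  rw [this, zero_mulVec]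

lemma finrank_fixedVectors_zero : Module.finrank F (fixedVectors (0 : Matrix ι ι F)) = 0 := by
  rw [Submodule.finrank_eq_zero, eq_bot_iff]
  intro x hx
  rw [mem_fixedVectors, zero_mulVec] at hx
  exact hx.symm

lemma finrank_fixedVectors_le (P : Matrix ι ι F) :
    Module.finrank F (fixedVectors P) ≤ Fintype.card ι :=
  (Submodule.finrank_le _).trans_eq (Module.finrank_fintype_fun_eq_card F)

lemma finrank_fixedVectors_add_one_sub [DecidableEq ι] {P : Matrix ι ι F}
    (hP : IsIdempotentElem P) :
    Module.finrank F (fixedVectors P) + Module.finrank F (fixedVectors (1 - P)) =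
      Fintype.card ι := by
  have h : IsCompl (fixedVectors P) (fixedVectors (1 - P)) := by
    constructor
    · rw [Submodule.disjoint_def]
      intro x hx hx'
      rw [mem_fixedVectors] at hx hx'
      rw [sub_mulVec, one_mulVec, hx, sub_self] at hx'
      exact hx'.symm
    · rw [codisjoint_iff, eq_top_iff]
      intro x _
      rw [Submodule.mem_sup]
      refine ⟨P *ᵥ x, ?_, (1 - P) *ᵥ x, ?_, ?_⟩
      · rw [mem_fixedVectors, mulVec_mulVec, hP.eq]
      · rw [mem_fixedVectors, mulVec_mulVec, hP.one_sub.eq]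
      · rw [sub_mulVec, one_mulVec, add_sub_cancel]
  rw [Submodule.finrank_add_eq_of_isCompl h, Module.finrank_fintype_fun_eq_card]

variable [StarRing F]

/-- The vectors `x` in the image of the idempotent matrix `P` with `⟨x, x⟩ = c`. -/
def vectorsOfNorm (P : Matrix ι ι F) (c : F) : Set (ι → F) :=
  {x | P *ᵥ x = x ∧ star x ⬝ᵥ x = c}

lemma star_dotProduct_mulVec {P : Matrix ι ι F} (hP : IsSelfAdjoint P) (x y : ι → F) :
    star x ⬝ᵥ P *ᵥ y = star (P *ᵥ x) ⬝ᵥ y := by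
  rw [star_mulVec, dotProduct_mulVec, ← star_eq_conjTranspose, hP.star_eq]

lemma star_star_dotProduct (x y : ι → F) : star (star x ⬝ᵥ y) = star y ⬝ᵥ x := by
  exact (star_dotProduct y x).symm

/-- A nonzero Hermitian idempotent has a unit vector in its image. If every `⟨P x, P x⟩` were zero,
polarization would give `a * ⟨x, P y⟩ + star (a * ⟨x, P y⟩) = 0` for all scalars `a`, and `P` would
vanish as `2 ≠ 0`; a vector with `⟨x, x⟩ ≠ 0` can be scaled as norms are surjective. -/
lemma exists_mem_vectorsOfNorm_one (h2 : (2 : F) ≠ 0)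
    (hN : ∀ c : F, star c = c → ∃ a : F, star a * a = c) {P : Matrix ι ι F}
    (hP : IsStarProjection P) (hP0 : P ≠ 0) : ∃ v, v ∈ vectorsOfNorm P 1 := by
  classical
  by_cases h : ∀ x : ι → F, star (P *ᵥ x) ⬝ᵥ (P *ᵥ x) = 0
  · exfalso
    apply hP0
    have hform : ∀ x y : ι → F, star x ⬝ᵥ P *ᵥ y = 0 := by
      intro x y
      by_contra hs
      have key : ∀ a : F, a * (star x ⬝ᵥ P *ᵥ y) + star (a * (star x ⬝ᵥ P *ᵥ y)) = 0 := by
        intro a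
        have h1 := h (x + a • y)
        have hx := h x
        have hy := h y
        rw [← star_dotProduct_mulVec hP.isSelfAdjoint, mulVec_mulVec, hP.isIdempotentElem.eq]
          at h1 hx hy
        have hxy : star y ⬝ᵥ P *ᵥ x = star (star x ⬝ᵥ P *ᵥ y) := by
          rw [star_star_dotProduct, ← star_dotProduct_mulVec hP.isSelfAdjoint]
        rw [mulVec_add, mulVec_smul, star_add, star_smul, add_dotProduct, dotProduct_add,
          dotProduct_add, hx, dotProduct_smul, smul_dotProduct, smul_dotProduct, dotProduct_smul,
          hy, hxy] at h1
        simp only [smul_eq_mul, mul_zero, add_zero, zero_add] at h1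
        rw [star_mul', h1]
      have h1 := key (star x ⬝ᵥ P *ᵥ y)⁻¹
      rw [inv_mul_cancel₀ hs, star_one] at h1
      exact h2 (by rw [← h1]; norm_num)
    refine Matrix.ext_of_mulVec_single fun i => ?_
    ext j
    have := hform (Pi.single j 1) (Pi.single i 1)
    rw [← Pi.single_star, star_one, single_dotProduct, one_mul] at this
    rw [this, zero_mulVec, Pi.zero_apply]
  · push Not at h
    obtain ⟨x, hx⟩ := h
    set w := P *ᵥ x with hw
    obtain ⟨a, ha⟩ := hN (star w ⬝ᵥ w) (star_star_dotProduct w w)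
    have ha0 : a ≠ 0 := by
      rintro rfl
      exact hx (by rw [← ha, mul_zero])
    refine ⟨a⁻¹ • w, ?_, ?_⟩
    · rw [mulVec_smul, hw, mulVec_mulVec, hP.isIdempotentElem.eq]
    · rw [star_smul, smul_dotProduct, dotProduct_smul, ← ha, star_inv₀]
      have : star a ≠ 0 := star_ne_zero.2 ha0
      simp only [smul_eq_mul]
      field_simp

/-- Removing a unit vector from the image of a Hermitian idempotent. -/
lemma IsStarProjection.sub_vecMulVec {P : Matrix ι ι F} (hP : IsStarProjection P) {v : ι → F}
    (hv : v ∈ vectorsOfNorm P 1) : IsStarProjection (P - vecMulVec v (star v)) := by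
  obtain ⟨hv1, hv2⟩ := hv
  have hv3 : star v ᵥ* P = star v := by
    have := congrArg star hv1
    rwa [star_mulVec, ← star_eq_conjTranspose, hP.isSelfAdjoint.star_eq] at this
  refine ⟨?_, ?_⟩
  · change _ * _ = _
    rw [sub_mul, mul_sub, mul_sub, hP.isIdempotentElem.eq, mul_vecMulVec, vecMulVec_mul, hv1, hv3,
      vecMulVec_mul_vecMulVec, hv2, one_smul]
    abel
  · change star _ = _
    rw [star_sub, hP.isSelfAdjoint.star_eq, star_eq_conjTranspose, conjTranspose_vecMulVec,
      star_star]

/-- Adding a unit vector orthogonal to the image of a Hermitian idempotent. -/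
lemma IsStarProjection.add_vecMulVec [DecidableEq ι] {P : Matrix ι ι F} (hP : IsStarProjection P)
    {v : ι → F} (hv : v ∈ vectorsOfNorm (1 - P) 1) :
    IsStarProjection (P + vecMulVec v (star v)) := by
  have h := (hP.one_sub.sub_vecMulVec hv).one_sub
  rwa [sub_sub, sub_sub_cancel] at h

/-- `vectorsOfNorm (1 - P) c` consists of the vectors of norm `c` killed by `P`. -/
lemma mem_vectorsOfNorm_one_sub [DecidableEq ι] {P : Matrix ι ι F} {c : F} {v : ι → F} :
    v ∈ vectorsOfNorm (1 - P) c ↔ P *ᵥ v = 0 ∧ star v ⬝ᵥ v = c := by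
  change _ ∧ _ ↔ _
  rw [sub_mulVec, one_mulVec, sub_eq_self]

lemma sub_vecMulVec_mulVec_self {P : Matrix ι ι F} {v : ι → F} (hv : v ∈ vectorsOfNorm P 1) :
    (P - vecMulVec v (star v)) *ᵥ v = 0 := by
  rw [sub_mulVec, hv.1, vecMulVec_mulVec, hv.2]
  simp

/-- The image of `P` is the orthogonal sum of the line spanned by a unit vector `v` and of the
image of `P - v v*`. -/
def fixedVectorsEquivProd {P : Matrix ι ι F} (hP : IsStarProjection P) {v : ι → F}
    (hv : v ∈ vectorsOfNorm P 1) :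
    (F × fixedVectors (P - vecMulVec v (star v))) ≃ₗ[F] fixedVectors P where
  toFun p := ⟨p.1 • v + p.2.1, by
    have h : P *ᵥ p.2.1 = p.2.1 := by
      have h1 : (P - vecMulVec v (star v)) *ᵥ p.2.1 = p.2.1 := p.2.2
      rw [← h1, mulVec_mulVec, mul_sub, mul_vecMulVec, hv.1, hP.isIdempotentElem.eq]
    rw [mem_fixedVectors, mulVec_add, mulVec_smul, hv.1, h]⟩
  map_add' p p' := by
    ext i
    simp
    ring
  map_smul' a p := by
    ext i
    simp
    ring
  invFun x := (star v ⬝ᵥ x.1, ⟨x.1 - (star v ⬝ᵥ x.1) • v, by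
    rw [mem_fixedVectors, mulVec_sub, mulVec_smul, sub_vecMulVec_mulVec_self hv, smul_zero,
      sub_zero, sub_mulVec, vecMulVec_mulVec, mem_fixedVectors.1 x.2]
    ext i
    simp⟩)
  left_inv p := by
    have h1 : (P - vecMulVec v (star v)) *ᵥ p.2.1 = p.2.1 := p.2.2
    have h : star v ⬝ᵥ p.2.1 = 0 := by
      rw [← h1, star_dotProduct_mulVec (hP.sub_vecMulVec hv).isSelfAdjoint,
        sub_vecMulVec_mulVec_self hv, star_zero, zero_dotProduct]
    have h2 : star v ⬝ᵥ (p.1 • v + p.2.1) = p.1 := by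
      rw [dotProduct_add, dotProduct_smul, hv.2, h, smul_eq_mul, mul_one, add_zero]
    refine Prod.ext h2 (Subtype.ext ?_)
    change p.1 • v + p.2.1 - (star v ⬝ᵥ (p.1 • v + p.2.1)) • v = p.2.1
    rw [h2, add_sub_cancel_left]
  right_inv x := by
    ext i
    simp

lemma star_dotProduct_fixedVectorsEquivProd {P : Matrix ι ι F} (hP : IsStarProjection P)
    {v : ι → F} (hv : v ∈ vectorsOfNorm P 1)
    (p : F × fixedVectors (P - vecMulVec v (star v))) :
    star (fixedVectorsEquivProd hP hv p).1 ⬝ᵥ (fixedVectorsEquivProd hP hv p).1 =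
      star p.1 * p.1 + star p.2.1 ⬝ᵥ p.2.1 := by
  have h1 : (P - vecMulVec v (star v)) *ᵥ p.2.1 = p.2.1 := p.2.2
  have h : star v ⬝ᵥ p.2.1 = 0 := by
    rw [← h1, star_dotProduct_mulVec (hP.sub_vecMulVec hv).isSelfAdjoint,
      sub_vecMulVec_mulVec_self hv, star_zero, zero_dotProduct]
  have h' : star p.2.1 ⬝ᵥ v = 0 := by
    rw [← star_star_dotProduct, h, star_zero]
  change star (p.1 • v + p.2.1) ⬝ᵥ (p.1 • v + p.2.1) = _
  rw [star_add, star_smul, add_dotProduct, dotProduct_add, dotProduct_add, smul_dotProduct,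
    smul_dotProduct, dotProduct_smul, dotProduct_smul, h, h', hv.2]
  simp

lemma finrank_fixedVectors_sub_vecMulVec {P : Matrix ι ι F} (hP : IsStarProjection P)
    {v : ι → F} (hv : v ∈ vectorsOfNorm P 1) :
    Module.finrank F (fixedVectors P) =
      Module.finrank F (fixedVectors (P - vecMulVec v (star v))) + 1 := by
  rw [← (fixedVectorsEquivProd hP hv).finrank_eq, Module.finrank_prod, Module.finrank_self,
    add_comm]

lemma mem_vectorsOfNorm_add_vecMulVec [DecidableEq ι] {P : Matrix ι ι F} {v : ι → F}
    (hv : v ∈ vectorsOfNorm (1 - P) 1) : v ∈ vectorsOfNorm (P + vecMulVec v (star v)) 1 := by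
  rw [mem_vectorsOfNorm_one_sub] at hv
  refine ⟨?_, hv.2⟩
  rw [add_mulVec, hv.1, vecMulVec_mulVec, hv.2]
  simp

lemma finrank_fixedVectors_add_vecMulVec [DecidableEq ι] {P : Matrix ι ι F}
    (hP : IsStarProjection P) {v : ι → F} (hv : v ∈ vectorsOfNorm (1 - P) 1) :
    Module.finrank F (fixedVectors (P + vecMulVec v (star v))) =
      Module.finrank F (fixedVectors P) + 1 := by
  have h := finrank_fixedVectors_sub_vecMulVec (hP.add_vecMulVec hv)
    (mem_vectorsOfNorm_add_vecMulVec hv)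
  rwa [add_sub_cancel_right] at h

end StarProjection

/-! ### Counting unit vectors -/

section UnitVectors

open Matrix

variable {ι F : Type*} [Fintype ι] [Field F] {q : ℕ}

lemma card_fixedVectors_eq_pow (hq : Odd q) (hF : Nat.card F = q ^ 2) (P : Matrix ι ι F) :
    Nat.card (fixedVectors P) = (q ^ 2) ^ Module.finrank F (fixedVectors P) := by
  have := finite_of_card_eq_sq hq hF
  rw [Module.natCard_eq_pow_finrank (K := F), hF]

variable [StarRing F]

lemma card_vectorsOfNorm_star_mul_self (P : Matrix ι ι F) {a : F} (ha : a ≠ 0) :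
    Nat.card (vectorsOfNorm P (star a * a)) = Nat.card (vectorsOfNorm P 1) := by
  have ha' : star a ≠ 0 := star_ne_zero.2 ha
  refine Nat.card_congr
    { toFun := fun x => ⟨a⁻¹ • x.1, ?_, ?_⟩
      invFun := fun x => ⟨a • x.1, ?_, ?_⟩
      left_inv := fun x => Subtype.ext (smul_inv_smul₀ ha x.1)
      right_inv := fun x => Subtype.ext (inv_smul_smul₀ ha x.1) }
  · rw [mulVec_smul, x.2.1]
  · rw [star_smul, smul_dotProduct, dotProduct_smul, x.2.2, star_inv₀, smul_eq_mul, smul_eq_mul]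
    field_simp
  · rw [mulVec_smul, x.2.1]
  · rw [star_smul, smul_dotProduct, dotProduct_smul, x.2.2, smul_eq_mul, smul_eq_mul, mul_one]

lemma card_vectorsOfNorm (hq : Odd q) (hF : Nat.card F = q ^ 2) (hs : ∀ a : F, star a = a ^ q)
    (P : Matrix ι ι F) {c : F} (hc : star c = c) (hc0 : c ≠ 0) :
    Nat.card (vectorsOfNorm P c) = Nat.card (vectorsOfNorm P 1) := by
  obtain ⟨a, rfl⟩ := exists_star_mul_self_eq hq hF hs hc
  exact card_vectorsOfNorm_star_mul_self P (right_ne_zero_of_mul hc0)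

/-- Sorting the vectors of the image of `P` by their norm, an element of the field with `q`
elements. -/
lemma card_fixedVectors_eq_add (hq : Odd q) (hF : Nat.card F = q ^ 2)
    (hs : ∀ a : F, star a = a ^ q) (P : Matrix ι ι F) :
    Nat.card (fixedVectors P) =
      Nat.card (vectorsOfNorm P 0) + (q - 1) * Nat.card (vectorsOfNorm P 1) := by
  classical
  have := finite_of_card_eq_sq hq hF
  have : Fintype F := Fintype.ofFinite F
  let e : (Σ c : F, vectorsOfNorm P c) ≃ fixedVectors P :=
    { toFun := fun x => ⟨x.2.1, x.2.2.1⟩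
      invFun := fun x => ⟨star x.1 ⬝ᵥ x.1, x.1, x.2, rfl⟩
      left_inv := by
        rintro ⟨c, x, hx, rfl⟩
        rfl
      right_inv := fun x => rfl }
  have hval : ∀ c : F, Nat.card (vectorsOfNorm P c) =
      (if c = 0 then Nat.card (vectorsOfNorm P 0) else 0) +
        if star c = c ∧ c ≠ 0 then Nat.card (vectorsOfNorm P 1) else 0 := by
    intro c
    by_cases hc0 : c = 0
    · simp [hc0]
    by_cases hc : star c = c
    · rw [if_neg hc0, if_pos ⟨hc, hc0⟩, zero_add, card_vectorsOfNorm hq hF hs P hc hc0]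
    · have : IsEmpty (vectorsOfNorm P c) := ⟨fun x => hc (by
        rw [← x.2.2, star_star_dotProduct])⟩
      simp [hc0, hc]
  rw [← Nat.card_congr e, Nat.card_sigma, Finset.sum_congr rfl fun c _ => hval c,
    Finset.sum_add_distrib, Finset.sum_ite_eq' Finset.univ (0 : F), if_pos (Finset.mem_univ _),
    ← Finset.sum_filter, Finset.sum_const, smul_eq_mul, ← card_star_eq_self hq hF hs,
    Nat.card_eq_fintype_card (α := {c : F // star c = c ∧ c ≠ 0}), Fintype.card_subtype]

/-- Sorting the isotropic vectors of the image of `P` by their component along a unit vector. -/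
lemma card_vectorsOfNorm_zero (hq : Odd q) (hF : Nat.card F = q ^ 2)
    (hs : ∀ a : F, star a = a ^ q) {P : Matrix ι ι F} (hP : IsStarProjection P) {v : ι → F}
    (hv : v ∈ vectorsOfNorm P 1) :
    Nat.card (vectorsOfNorm P 0) = Nat.card (vectorsOfNorm (P - vecMulVec v (star v)) 0) +
      (q ^ 2 - 1) * Nat.card (vectorsOfNorm (P - vecMulVec v (star v)) 1) := by
  classical
  have := finite_of_card_eq_sq hq hF
  have : Fintype F := Fintype.ofFinite F
  set Q := P - vecMulVec v (star v) with hQ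
  let e : (Σ a : F, vectorsOfNorm Q (-(star a * a))) ≃ vectorsOfNorm P 0 :=
    { toFun := fun x => ⟨(fixedVectorsEquivProd hP hv (x.1, ⟨x.2.1, x.2.2.1⟩)).1,
        (fixedVectorsEquivProd hP hv (x.1, ⟨x.2.1, x.2.2.1⟩)).2, by
          rw [star_dotProduct_fixedVectorsEquivProd hP hv]
          exact (congrArg (star x.1 * x.1 + ·) x.2.2.2).trans (add_neg_cancel _)⟩
      invFun := fun x => ⟨((fixedVectorsEquivProd hP hv).symm ⟨x.1, x.2.1⟩).1,
        ((fixedVectorsEquivProd hP hv).symm ⟨x.1, x.2.1⟩).2.1,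
        ((fixedVectorsEquivProd hP hv).symm ⟨x.1, x.2.1⟩).2.2, by
          have h := star_dotProduct_fixedVectorsEquivProd hP hv
            ((fixedVectorsEquivProd hP hv).symm ⟨x.1, x.2.1⟩)
          rw [LinearEquiv.apply_symm_apply] at h
          exact (neg_eq_of_add_eq_zero_right (h.symm.trans x.2.2)).symm⟩
      left_inv := by
        rintro ⟨a, y, hy⟩
        have h := (fixedVectorsEquivProd hP hv).symm_apply_apply (a, ⟨y, hy.1⟩)
        refine Sigma.subtype_ext ?_ ?_
        · exact congrArg Prod.fst h
        · exact congrArg (fun p => p.2.1) h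
      right_inv := fun x => Subtype.ext (by
        have h := congrArg Subtype.val
          ((fixedVectorsEquivProd hP hv).apply_symm_apply ⟨x.1, x.2.1⟩)
        exact h) }
  have hval : ∀ a ∈ ({0} : Finset F)ᶜ, Nat.card (vectorsOfNorm Q (-(star a * a))) =
      Nat.card (vectorsOfNorm Q 1) := by
    intro a ha
    have ha0 : a ≠ 0 := by simpa using ha
    refine card_vectorsOfNorm hq hF hs Q ?_ (neg_ne_zero.2 (mul_ne_zero (star_ne_zero.2 ha0) ha0))
    rw [star_neg, star_mul', star_star, mul_comm]
  rw [← Nat.card_congr e, Nat.card_sigma, Fintype.sum_eq_add_sum_compl (0 : F),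
    Finset.sum_congr rfl hval, Finset.sum_const, Finset.card_compl, Finset.card_singleton,
    ← Nat.card_eq_fintype_card, hF, star_zero, zero_mul, neg_zero, smul_eq_mul]

/-- The number of unit vectors in the image of a Hermitian idempotent of rank `r` is
`q ^ (r - 1) * (q ^ r - (-1) ^ r)`; multiplied by `q`, the formula also makes sense for `r = 0`. -/
lemma mul_card_vectorsOfNorm_one (hq : Odd q) (hF : Nat.card F = q ^ 2)
    (hs : ∀ a : F, star a = a ^ q) (r : ℕ) :
    ∀ P : Matrix ι ι F, IsStarProjection P → Module.finrank F (fixedVectors P) = r →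
      (q : ℤ) * Nat.card (vectorsOfNorm P 1) = q ^ r * (q ^ r - (-1) ^ r) := by
  induction r with
  | zero =>
    intro P hP hr
    have hP0 := eq_zero_of_finrank_fixedVectors_eq_zero hP.isIdempotentElem hr
    have : IsEmpty (vectorsOfNorm P 1) := ⟨by
      rintro ⟨x, h1, h2⟩
      rw [hP0, zero_mulVec] at h1
      rw [← h1, dotProduct_zero] at h2
      exact zero_ne_one h2⟩
    simp
  | succ r ih =>
    intro P hP hr
    have hP0 : P ≠ 0 := by
      rintro rfl
      rw [finrank_fixedVectors_zero] at hr
      exact absurd hr (Nat.succ_ne_zero r).symm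
    obtain ⟨v, hv⟩ := exists_mem_vectorsOfNorm_one (two_ne_zero_of_card_eq hq hF)
      (fun c hc => exists_star_mul_self_eq hq hF hs hc) hP hP0
    have hQr := finrank_fixedVectors_sub_vecMulVec hP hv
    rw [hr, Nat.succ_inj] at hQr
    have hQ := ih _ (hP.sub_vecMulVec hv) hQr.symm
    have h1 := card_fixedVectors_eq_add hq hF hs P
    have h2 := card_fixedVectors_eq_add hq hF hs (P - vecMulVec v (star v))
    have h3 := card_vectorsOfNorm_zero hq hF hs hP hv
    rw [card_fixedVectors_eq_pow hq hF, hr] at h1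
    rw [card_fixedVectors_eq_pow hq hF, ← hQr] at h2
    rw [h3] at h1
    zify [hq.pos, Nat.one_le_pow 2 q hq.pos] at h1 h2
    rcases Nat.eq_or_lt_of_le (Nat.succ_le_of_lt hq.pos) with hq1 | hq1
    · have := finite_of_card_eq_sq hq hF
      have h := Finite.one_lt_card (α := F)
      rw [hF, ← hq1] at h
      exact absurd h (by norm_num)
    · have hq1' : (q : ℤ) - 1 ≠ 0 := by
        have : (1 : ℤ) < q := by exact_mod_cast hq1
        linarith
      refine mul_left_cancel₀ hq1' ?_
      -- The counts for `P` and `Q = P - v v*` combine to `U P = (q + 1) * q ^ (2 * r) - q * U Q`.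
      rw [← pow_mul, mul_comm 2, pow_mul] at h1 h2
      linear_combination (-(q : ℤ)) * h1 + (q : ℤ) * h2 - (q : ℤ) * (q - 1) * hQ

end UnitVectors

/-! ### Counting Hermitian idempotents and unitary involutions -/

section Count

open Matrix

/-- The Hermitian idempotent matrices of rank `r`. -/
def starProjectionsOfRank (ι F : Type*) [Fintype ι] [Field F] [StarRing F] (r : ℕ) :
    Set (Matrix ι ι F) :=
  {P | IsStarProjection P ∧ Module.finrank F (fixedVectors P) = r}

variable {ι F : Type*} [Fintype ι] [Field F] [StarRing F] {q : ℕ}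

lemma card_starProjectionsOfRank_zero : Nat.card (starProjectionsOfRank ι F 0) = 1 := by
  have h : starProjectionsOfRank ι F 0 = {0} := by
    ext P
    refine ⟨fun hP => eq_zero_of_finrank_fixedVectors_eq_zero hP.1.isIdempotentElem hP.2, ?_⟩
    rintro rfl
    exact ⟨IsStarProjection.zero _, finrank_fixedVectors_zero⟩
  rw [h, Nat.card_unique]

lemma card_isStarProjection (hq : Odd q) (hF : Nat.card F = q ^ 2) :
    Nat.card {P : Matrix ι ι F // IsStarProjection P} =
      ∑ r ∈ Finset.range (Fintype.card ι + 1), Nat.card (starProjectionsOfRank ι F r) := by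
  have := finite_of_card_eq_sq hq hF
  have : Finite (Matrix ι ι F) := inferInstanceAs (Finite (ι → ι → F))
  let e : (Σ r : Fin (Fintype.card ι + 1), starProjectionsOfRank ι F r) ≃
      {P : Matrix ι ι F // IsStarProjection P} :=
    { toFun := fun x => ⟨x.2.1, x.2.2.1⟩
      invFun := fun P => ⟨⟨Module.finrank F (fixedVectors P.1),
        Nat.lt_succ_of_le (finrank_fixedVectors_le P.1)⟩, P.1, P.2, rfl⟩
      left_inv := fun x => Sigma.subtype_ext (Fin.ext x.2.2.2) rfl
      right_inv := fun P => rfl }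
  rw [← Nat.card_congr e, Nat.card_sigma,
    Finset.sum_range fun r => Nat.card (starProjectionsOfRank ι F r)]

variable [DecidableEq ι]

/-- A Hermitian idempotent `P` of rank `r + 1` with a unit vector `v` in its image amounts to a
Hermitian idempotent of rank `r`, namely `P - v v*`, with a unit vector `v` in its kernel. -/
def sigmaVectorsOfNormEquiv (r : ℕ) :
    (Σ P : starProjectionsOfRank ι F (r + 1), vectorsOfNorm P.1 1) ≃
      Σ Q : starProjectionsOfRank ι F r, vectorsOfNorm (1 - Q.1) 1 where
  toFun x := ⟨⟨x.1.1 - vecMulVec x.2.1 (star x.2.1), x.1.2.1.sub_vecMulVec x.2.2, by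
      have h := finrank_fixedVectors_sub_vecMulVec x.1.2.1 x.2.2
      rw [x.1.2.2] at h
      exact (Nat.succ_inj.1 h).symm⟩,
    x.2.1, mem_vectorsOfNorm_one_sub.2 ⟨sub_vecMulVec_mulVec_self x.2.2, x.2.2.2⟩⟩
  invFun x := ⟨⟨x.1.1 + vecMulVec x.2.1 (star x.2.1), x.1.2.1.add_vecMulVec x.2.2,
      (finrank_fixedVectors_add_vecMulVec x.1.2.1 x.2.2).trans (congrArg (· + 1) x.1.2.2)⟩,
    x.2.1, mem_vectorsOfNorm_add_vecMulVec x.2.2⟩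
  left_inv := by
    rintro ⟨⟨P, hP⟩, v, hv⟩
    refine Sigma.subtype_ext (Subtype.ext ?_) rfl
    exact sub_add_cancel P (vecMulVec v (star v))
  right_inv := by
    rintro ⟨⟨Q, hQ⟩, v, hv⟩
    refine Sigma.subtype_ext (Subtype.ext ?_) rfl
    exact add_sub_cancel_right Q (vecMulVec v (star v))

/-- Both sides count the pairs of `sigmaVectorsOfNormEquiv`, up to a factor `q`. The truncated
subtraction is harmless, since there is no matrix of rank `r` for `r > Fintype.card ι`. -/
lemma card_starProjectionsOfRank_succ (hq : Odd q) (hF : Nat.card F = q ^ 2)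
    (hs : ∀ a : F, star a = a ^ q) (r : ℕ) :
    (Nat.card (starProjectionsOfRank ι F (r + 1)) : ℤ) *
        (q ^ (r + 1) * (q ^ (r + 1) - (-1) ^ (r + 1))) =
      Nat.card (starProjectionsOfRank ι F r) *
        (q ^ (Fintype.card ι - r) * (q ^ (Fintype.card ι - r) - (-1) ^ (Fintype.card ι - r))) := by
  classical
  have := finite_of_card_eq_sq hq hF
  have : Finite (Matrix ι ι F) := inferInstanceAs (Finite (ι → ι → F))
  have := fun r => Fintype.ofFinite (starProjectionsOfRank ι F r)
  have h := Nat.card_congr (sigmaVectorsOfNormEquiv (ι := ι) (F := F) r)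
  rw [Nat.card_sigma, Nat.card_sigma] at h
  have h' := congrArg (fun k : ℕ => (q : ℤ) * k) h
  simp only [Nat.cast_sum, Finset.mul_sum] at h'
  rw [Finset.sum_congr rfl fun P _ => mul_card_vectorsOfNorm_one hq hF hs (r + 1) P.1 P.2.1 P.2.2,
    Finset.sum_congr rfl fun (Q : starProjectionsOfRank ι F r) _ =>
      mul_card_vectorsOfNorm_one hq hF hs (Fintype.card ι - r) (1 - Q.1) Q.2.1.one_sub (by
        rw [← finrank_fixedVectors_add_one_sub Q.2.1.isIdempotentElem, Q.2.2,
          Nat.add_sub_cancel_left])] at h'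
  simpa only [Finset.sum_const, Finset.card_univ, ← Nat.card_eq_fintype_card, nsmul_eq_mul] using h'

lemma mem_finiteUnitaryGroup_iff {n : ℕ} (hs : ∀ a : F, star a = a ^ q) (g : GL (Fin n) F) :
    g ∈ finiteUnitaryGroup n q F ↔ star (g : Matrix (Fin n) (Fin n) F) * g = 1 := by
  have hform : ∀ x y : Fin n → F, hermitianForm q x y = star y ⬝ᵥ x := by
    intro x y
    rw [dotProduct_comm]
    exact Finset.sum_congr rfl fun i _ => by rw [Pi.star_apply, hs]
  have hadj : ∀ x y : Fin n → F, star ((g : Matrix (Fin n) (Fin n) F) *ᵥ y) ⬝ᵥ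
      ((g : Matrix (Fin n) (Fin n) F) *ᵥ x) =
        star y ⬝ᵥ (star (g : Matrix (Fin n) (Fin n) F) * (g : Matrix (Fin n) (Fin n) F)) *ᵥ x := by
    intro x y
    rw [star_mulVec, ← mulVec_mulVec, dotProduct_mulVec _ _ ((g : Matrix (Fin n) (Fin n) F) *ᵥ x),
      star_eq_conjTranspose]
  change (∀ x y : Fin n → F, _) ↔ _
  simp only [hform, hadj]
  constructor
  · intro h
    refine Matrix.ext_of_mulVec_single fun i => ?_
    ext j
    have := h (Pi.single i 1) (Pi.single j 1)
    rw [← Pi.single_star, star_one, single_dotProduct, one_mul, single_dotProduct, one_mul] at this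
    rw [this, one_mulVec]
  · intro h x y
    rw [h, one_mulVec]

/-- Unitary involutions `g` correspond to Hermitian idempotents `(1 + g) / 2`. -/
def unitaryInvolutionsEquiv {n : ℕ} (h2 : (2 : F) ≠ 0) (hs : ∀ a : F, star a = a ^ q) :
    {g : finiteUnitaryGroup n q F // g ^ 2 = 1} ≃
      {P : Matrix (Fin n) (Fin n) F // IsStarProjection P} where
  toFun g := ⟨(2⁻¹ : F) • (1 + (g.1.1 : Matrix (Fin n) (Fin n) F)), by
    have hg : (g.1.1 : Matrix (Fin n) (Fin n) F) * g.1.1 = 1 := by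
      have h := congrArg (fun u : finiteUnitaryGroup n q F => (u.1 : Matrix (Fin n) (Fin n) F)) g.2
      simpa [sq] using h
    have hstar : star (g.1.1 : Matrix (Fin n) (Fin n) F) = g.1.1 := by
      have h := (mem_finiteUnitaryGroup_iff hs g.1.1).1 g.1.2
      have h' := congrArg (· * (g.1.1 : Matrix (Fin n) (Fin n) F)) h
      simpa [mul_assoc, hg] using h'
    refine ⟨?_, ?_⟩
    · change _ * _ = _
      rw [smul_mul_smul_comm, add_mul, mul_add, mul_add, hg, mul_smul]
      congr 1
      rw [one_mul, mul_one, one_mul, add_comm (g.1.1 : Matrix (Fin n) (Fin n) F) 1, ← two_smul F,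
        inv_smul_smul₀ h2]
    · change star _ = _
      rw [star_smul, star_add, star_one, hstar, star_inv₀, star_ofNat]⟩
  invFun P :=
    have hP : (2 • P.1 - 1) * (2 • P.1 - 1) = (1 : Matrix (Fin n) (Fin n) F) := by
      rw [sub_mul, mul_sub, smul_mul_smul_comm, P.2.isIdempotentElem.eq, mul_one, one_mul]
      rw [mul_smul, two_smul, two_smul]
      abel
    ⟨⟨⟨2 • P.1 - 1, 2 • P.1 - 1, hP, hP⟩, by
      rw [mem_finiteUnitaryGroup_iff hs]
      change star (2 • P.1 - 1) * (2 • P.1 - 1) = (1 : Matrix (Fin n) (Fin n) F)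
      rw [star_sub, star_nsmul, star_one, P.2.isSelfAdjoint.star_eq, hP]⟩,
      Subtype.ext (Units.ext ((sq (2 • P.1 - 1)).trans hP))⟩
  left_inv g := by
    refine Subtype.ext (Subtype.ext (Units.ext ?_))
    change 2 • ((2⁻¹ : F) • (1 + (g.1.1 : Matrix (Fin n) (Fin n) F))) - 1 = g.1.1
    rw [← ofNat_smul_eq_nsmul F 2, smul_inv_smul₀ h2, add_sub_cancel_left]
  right_inv P := by
    refine Subtype.ext ?_
    change (2⁻¹ : F) • (1 + (2 • P.1 - 1)) = P.1
    rw [add_sub_cancel, ← ofNat_smul_eq_nsmul F 2, inv_smul_smul₀ h2]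

lemma unitaryInvolutionCount_eq_sum {n : ℕ} (hq : Odd q) (hF : Nat.card F = q ^ 2)
    (hs : ∀ a : F, star a = a ^ q) :
    unitaryInvolutionCount n q F =
      ∑ r ∈ Finset.range (n + 1), Nat.card (starProjectionsOfRank (Fin n) F r) := by
  rw [unitaryInvolutionCount,
    Nat.card_congr (unitaryInvolutionsEquiv (two_ne_zero_of_card_eq hq hF) hs),
    card_isStarProjection hq hF, Fintype.card_fin]

end Count

/-! ### Gaussian binomial coefficients and the `q`-binomial theorem -/

section GaussBinom

/-- The partial product `∏ i ∈ {1, …, n}, (1 - s ^ i)`. -/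
def eulerProd (s : ℝ) (n : ℕ) : ℝ := ∏ i ∈ Finset.range n, (1 - s ^ (i + 1))

lemma eulerProd_zero (s : ℝ) : eulerProd s 0 = 1 := Finset.prod_range_zero _

lemma eulerProd_succ (s : ℝ) (n : ℕ) : eulerProd s (n + 1) = eulerProd s n * (1 - s ^ (n + 1)) :=
  Finset.prod_range_succ _ _

/-- The Gaussian binomial coefficient with parameter `s`, defined like `Nat.choose` by Pascal's
rule, so that it vanishes for `n < k`. -/
def gaussBinom (s : ℝ) : ℕ → ℕ → ℝ
  | _, 0 => 1
  | 0, _ + 1 => 0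
  | n + 1, k + 1 => gaussBinom s n (k + 1) + s ^ (n - k) * gaussBinom s n k

lemma gaussBinom_zero_right (s : ℝ) (n : ℕ) : gaussBinom s n 0 = 1 := by
  cases n <;> rfl

lemma gaussBinom_succ_succ (s : ℝ) (n k : ℕ) : gaussBinom s (n + 1) (k + 1) =
    gaussBinom s n (k + 1) + s ^ (n - k) * gaussBinom s n k := rfl

lemma gaussBinom_eq_zero_of_lt (s : ℝ) {n k : ℕ} (h : n < k) : gaussBinom s n k = 0 := by
  induction n generalizing k with
  | zero =>
    obtain ⟨k, rfl⟩ := Nat.exists_eq_succ_of_ne_zero h.ne'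
    rfl
  | succ n ih =>
    obtain ⟨k, rfl⟩ := Nat.exists_eq_succ_of_ne_zero (Nat.ne_zero_of_lt h)
    rw [gaussBinom_succ_succ, ih (by omega), ih (by omega), mul_zero, add_zero]

/-- The closed formula, in a form that needs no division. -/
lemma gaussBinom_mul_eulerProd (s : ℝ) (a b : ℕ) :
    gaussBinom s (a + b) a * (eulerProd s a * eulerProd s b) = eulerProd s (a + b) := by
  induction h : a + b generalizing a b with
  | zero =>
    obtain ⟨rfl, rfl⟩ := Nat.add_eq_zero_iff.1 h
    rw [gaussBinom_zero_right, eulerProd_zero]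
    norm_num
  | succ n ih =>
    rcases a with _ | a
    · rw [zero_add] at h
      rw [gaussBinom_zero_right, eulerProd_zero, h]
      ring
    rw [gaussBinom_succ_succ]
    rcases b with _ | b
    · rw [gaussBinom_eq_zero_of_lt s (by omega), show n - a = 0 by omega]
      have h1 := ih a 0 (by omega)
      obtain rfl : a = n := by omega
      rw [eulerProd_succ]
      linear_combination (1 - s ^ (a + 1)) * h1
    · have h1 := ih (a + 1) b (by omega)
      have h2 := ih a (b + 1) (by omega)
      obtain rfl : n = a + b + 1 := by omega
      rw [show a + b + 1 - a = b + 1 by omega, eulerProd_succ s (a + b + 1)]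
      rw [eulerProd_succ s b] at h2 ⊢
      rw [eulerProd_succ s a] at h1 ⊢
      linear_combination (1 - s ^ (b + 1)) * h1 + s ^ (b + 1) * (1 - s ^ (a + 1)) * h2

/-- The `q`-binomial theorem. -/
lemma prod_one_add_mul_pow (s z : ℝ) (n : ℕ) : ∏ i ∈ Finset.range n, (1 + z * s ^ i) =
    ∑ k ∈ Finset.range (n + 1), gaussBinom s n k * (s ^ k.choose 2 * z ^ k) := by
  induction n with
  | zero => simp [gaussBinom_zero_right]
  | succ n ih =>
    have h1 := Finset.sum_range_succ' (fun k => gaussBinom s n k * (s ^ k.choose 2 * z ^ k)) (n + 1)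
    rw [Finset.sum_range_succ, gaussBinom_eq_zero_of_lt s (Nat.lt_succ_self n), zero_mul, add_zero,
      ← ih] at h1
    rw [Finset.sum_range_succ', Finset.prod_range_succ, mul_add, mul_one]
    nth_rw 1 [h1]
    rw [ih, Finset.sum_mul, gaussBinom_zero_right, gaussBinom_zero_right, add_right_comm,
      ← Finset.sum_add_distrib]
    congr 1
    refine Finset.sum_congr rfl fun k hk => ?_
    have hk' : k ≤ n := Nat.lt_succ_iff.1 (Finset.mem_range.1 hk)
    have hc : (k + 1).choose 2 = k + k.choose 2 := by
      rw [Nat.choose_succ_succ' k 1, Nat.choose_one_right]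
    have hn : s ^ n = s ^ (n - k) * s ^ k := by rw [← pow_add, Nat.sub_add_cancel hk']
    rw [gaussBinom_succ_succ, hc, hn, pow_add, pow_succ z]
    ring

lemma two_mul_choose_two (k : ℕ) : 2 * (k.choose 2 : ℤ) = k ^ 2 - k := by
  induction k with
  | zero => simp
  | succ k ih =>
    rw [Nat.choose_succ_succ' k 1, Nat.choose_one_right]
    push_cast
    linarith

/-- The finite form of Jacobi's triple product: the `q`-binomial theorem with parameter `t ^ 2` at
`z * t ^ (1 - 2 * m)`, whose factors are `1 + z * t ^ i` for the odd `i` between `-2 * m` and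
`2 * m`. -/
lemma prod_one_add_mul_one_add_inv {t z : ℝ} (ht : t ≠ 0) (hz : z ≠ 0) (m : ℕ) :
    ∏ l ∈ Finset.range m, ((1 + z * t ^ (2 * l + 1)) * (1 + z⁻¹ * t ^ (2 * l + 1))) =
      ∑ k ∈ Finset.range (2 * m + 1), gaussBinom (t ^ 2) (2 * m) k *
        (t ^ (((k : ℤ) - m) ^ 2) * z ^ ((k : ℤ) - m)) := by
  -- The factors with a negative power of `t`.
  have hlow : ∀ m : ℕ, z ^ m * ∏ l ∈ Finset.range m, (1 + z⁻¹ * t ^ (2 * l + 1)) =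
      t ^ (m ^ 2) *
        ∏ i ∈ Finset.range m, (1 + z * t ^ (1 - 2 * (m : ℤ)) * (t ^ 2) ^ i) := by
    intro m
    rw [← Finset.prod_range_reflect (fun i => 1 + z * t ^ (1 - 2 * (m : ℤ)) * (t ^ 2) ^ i)]
    have hpow : t ^ (m ^ 2) = ∏ l ∈ Finset.range m, t ^ (2 * l + 1) := by
      rw [Finset.prod_pow_eq_pow_sum]
      congr 1
      induction m with
      | zero => rfl
      | succ m ih => rw [Finset.sum_range_succ, ← ih]; ring
    have hz' : z ^ m = ∏ l ∈ Finset.range m, z := by simp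
    rw [hpow, hz', ← Finset.prod_mul_distrib, ← Finset.prod_mul_distrib]
    refine Finset.prod_congr rfl fun l hl => ?_
    have hl' := Finset.mem_range.1 hl
    have hexp : t ^ (2 * l + 1) * (t ^ (1 - 2 * (m : ℤ)) * (t ^ 2) ^ (m - 1 - l)) = 1 := by
      rw [← pow_mul, ← zpow_natCast, ← zpow_natCast, ← zpow_add₀ ht, ← zpow_add₀ ht]
      rw [show ((2 * l + 1 : ℕ) : ℤ) + (1 - 2 * (m : ℤ) + ((2 * (m - 1 - l) : ℕ) : ℤ)) = 0 by omega,
        zpow_zero]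
    rw [mul_add, mul_add, mul_inv_cancel_left₀ hz]
    linear_combination (-z) * hexp
  have hhigh : ∏ l ∈ Finset.range m, (1 + z * t ^ (2 * l + 1)) =
      ∏ l ∈ Finset.range m, (1 + z * t ^ (1 - 2 * (m : ℤ)) * (t ^ 2) ^ (m + l)) := by
    refine Finset.prod_congr rfl fun l _ => ?_
    rw [mul_assoc, ← pow_mul, ← zpow_natCast, ← zpow_natCast, ← zpow_add₀ ht]
    congr 3
    push_cast
    ring
  have hzm : z ^ m ≠ 0 := pow_ne_zero m hz
  refine mul_left_cancel₀ hzm ?_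
  rw [Finset.prod_mul_distrib, mul_left_comm, hlow, hhigh, mul_left_comm, mul_comm (∏ _ ∈ _, _),
    ← Finset.prod_range_add (fun i => 1 + z * t ^ (1 - 2 * (m : ℤ)) * (t ^ 2) ^ i), ← two_mul,
    prod_one_add_mul_pow, Finset.mul_sum, Finset.mul_sum]
  refine Finset.sum_congr rfl fun k _ => ?_
  have h1 : t ^ (m ^ 2) * ((t ^ 2) ^ k.choose 2 * (t ^ (1 - 2 * (m : ℤ))) ^ k) =
      t ^ (((k : ℤ) - m) ^ 2) := by
    rw [← pow_mul, ← zpow_natCast, ← zpow_natCast, ← zpow_natCast, ← zpow_mul, ← zpow_add₀ ht,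
      ← zpow_add₀ ht]
    congr 1
    have := two_mul_choose_two k
    push_cast
    linear_combination this
  have h2 : z ^ k = z ^ m * z ^ ((k : ℤ) - m) := by
    rw [← zpow_natCast, ← zpow_natCast, ← zpow_add₀ hz]
    congr 1
    ring
  rw [mul_pow, h2, ← h1]
  ring

end GaussBinom

/-! ### Limits of sums weighted by Gaussian binomial coefficients -/

section Limits

lemma summable_norm_pow_succ {s : ℝ} (hs : |s| < 1) : Summable fun i : ℕ => ‖-s ^ (i + 1)‖ := by
  simp only [norm_neg, norm_pow, Real.norm_eq_abs]
  exact (summable_nat_add_iff 1).2 (summable_geometric_of_lt_one (abs_nonneg s) hs)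

lemma multipliable_one_sub_pow {s : ℝ} (hs : |s| < 1) :
    Multipliable fun i : ℕ => 1 - s ^ (i + 1) := by
  simpa only [sub_eq_add_neg] using multipliable_one_add_of_summable (summable_norm_pow_succ hs)

lemma one_sub_pow_ne_zero {s : ℝ} (hs : |s| < 1) (i : ℕ) : 1 - s ^ (i + 1) ≠ 0 := by
  have h : |s ^ (i + 1)| < 1 := by
    rw [abs_pow]
    exact pow_lt_one₀ (abs_nonneg s) hs (Nat.succ_ne_zero i)
  exact (sub_pos.2 (abs_lt.1 h).2).ne'

lemma tprod_one_sub_pow_ne_zero {s : ℝ} (hs : |s| < 1) : ∏' i : ℕ, (1 - s ^ (i + 1)) ≠ 0 := by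
  simp only [sub_eq_add_neg]
  refine tprod_one_add_ne_zero_of_summable (fun i => ?_) (summable_norm_pow_succ hs)
  rw [← sub_eq_add_neg]
  exact one_sub_pow_ne_zero hs i

lemma eulerProd_ne_zero {s : ℝ} (hs : |s| < 1) (n : ℕ) : eulerProd s n ≠ 0 :=
  Finset.prod_ne_zero_iff.2 fun i _ => one_sub_pow_ne_zero hs i

lemma gaussBinom_add_eq_div {s : ℝ} (hs : |s| < 1) (a b : ℕ) :
    gaussBinom s (a + b) a = eulerProd s (a + b) / (eulerProd s a * eulerProd s b) := by
  rw [eq_div_iff (mul_ne_zero (eulerProd_ne_zero hs a) (eulerProd_ne_zero hs b)),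
    gaussBinom_mul_eulerProd]

lemma tendsto_eulerProd {s : ℝ} (hs : |s| < 1) :
    Tendsto (eulerProd s) atTop (𝓝 (∏' i : ℕ, (1 - s ^ (i + 1)))) :=
  (multipliable_one_sub_pow hs).hasProd.tendsto_prod_nat

/-- Boundedness holds because `eulerProd s` converges to a nonzero limit. -/
lemma exists_norm_gaussBinom_le {s : ℝ} (hs : |s| < 1) :
    ∃ C : ℝ, 0 ≤ C ∧ ∀ n k, ‖gaussBinom s n k‖ ≤ C := by
  obtain ⟨A, hA⟩ := (tendsto_eulerProd hs).norm.bddAbove_range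
  obtain ⟨B, hB⟩ := ((tendsto_eulerProd hs).inv₀ (tprod_one_sub_pow_ne_zero hs)).norm.bddAbove_range
  have hA' : ∀ n, ‖eulerProd s n‖ ≤ A := fun n => hA ⟨n, rfl⟩
  have hB' : ∀ n, ‖(eulerProd s n)⁻¹‖ ≤ B := fun n => hB ⟨n, rfl⟩
  have hA0 : 0 ≤ A := (norm_nonneg _).trans (hA' 0)
  have hB0 : 0 ≤ B := (norm_nonneg _).trans (hB' 0)
  refine ⟨A * (B * B), by positivity, fun n k => ?_⟩
  rcases lt_or_ge n k with h | h
  · rw [gaussBinom_eq_zero_of_lt s h, norm_zero]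
    positivity
  · obtain ⟨b, rfl⟩ := Nat.exists_eq_add_of_le h
    rw [gaussBinom_add_eq_div hs, div_eq_mul_inv, mul_inv, norm_mul, norm_mul]
    gcongr
    exacts [hA' _, hB' _, hB' _]

/-- Tannery's theorem for sums weighted by Gaussian binomial coefficients: those near the centre
tend to `1 / ∏ (1 - s ^ i)`. -/
lemma tendsto_sum_gaussBinom_mul {s : ℝ} (hs : |s| < 1) {w : ℤ → ℝ} (hw : Summable w) (c : ℕ) :
    Tendsto (fun m : ℕ => ∑ k ∈ Finset.range (2 * m + c + 1),
      gaussBinom s (2 * m + c) k * w ((k : ℤ) - m - c)) atTop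
        (𝓝 ((∑' j, w j) / ∏' i : ℕ, (1 - s ^ (i + 1)))) := by
  obtain ⟨C, hC0, hC⟩ := exists_norm_gaussBinom_le hs
  -- The summand for `k = m + c + j`; no upper bound on `j` is needed, as `gaussBinom s n k = 0` for
  -- `n < k`.
  let f : ℕ → ℤ → ℝ := fun m j =>
    if 0 ≤ j + m + c then gaussBinom s (2 * m + c) (j + m + c).toNat * w j else 0
  have hf : ∀ m : ℕ, ∑ k ∈ Finset.range (2 * m + c + 1),
      gaussBinom s (2 * m + c) k * w ((k : ℤ) - m - c) = ∑' j, f m j := by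
    intro m
    have hinj : Function.Injective fun k : ℕ => (k : ℤ) - m - c := by
      intro a b hab
      simp only at hab
      omega
    have hfk : ∀ k : ℕ, f m ((k : ℤ) - m - c) =
        gaussBinom s (2 * m + c) k * w ((k : ℤ) - m - c) := by
      intro k
      have : (k : ℤ) - m - c + m + c = k := by ring
      simp only [f]
      rw [this, if_pos (Int.natCast_nonneg k), Int.toNat_natCast]
    rw [← hinj.tsum_eq, tsum_eq_sum (s := Finset.range (2 * m + c + 1))]
    · exact Finset.sum_congr rfl fun k _ => (hfk k).symm
    · intro k hk
      rw [hfk, gaussBinom_eq_zero_of_lt s (by simpa using hk), zero_mul]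
    · intro j hj
      have h0 : 0 ≤ j + m + c := by
        by_contra h
        exact hj (if_neg h)
      exact ⟨(j + m + c).toNat, by simp only; omega⟩
  have hlim : (∑' j, w j) / ∏' i : ℕ, (1 - s ^ (i + 1)) =
      ∑' j, (∏' i : ℕ, (1 - s ^ (i + 1)))⁻¹ * w j := by
    rw [tsum_mul_left, div_eq_inv_mul]
  simp only [hf]
  rw [hlim]
  refine tendsto_tsum_of_dominated_convergence (bound := fun j => C * ‖w j‖)
    (hw.norm.mul_left C) (fun j => ?_) (Eventually.of_forall fun m j => ?_)
  · have ha : Tendsto (fun m : ℕ => (j + m + c).toNat) atTop atTop :=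
      tendsto_atTop.2 fun N => eventually_atTop.2 ⟨N + j.natAbs, fun m hm => by omega⟩
    have hb : Tendsto (fun m : ℕ => (m - j).toNat) atTop atTop :=
      tendsto_atTop.2 fun N => eventually_atTop.2 ⟨N + j.natAbs, fun m hm => by omega⟩
    have hn : Tendsto (fun m : ℕ => 2 * m + c) atTop atTop :=
      tendsto_atTop.2 fun N => eventually_atTop.2 ⟨N, fun m hm => by omega⟩
    have hP := tprod_one_sub_pow_ne_zero hs
    have hE := tendsto_eulerProd hs
    have h := ((hE.comp hn).div ((hE.comp ha).mul (hE.comp hb)) (mul_ne_zero hP hP)).mul_const (w j)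
    rw [div_mul_cancel_left₀ hP] at h
    refine h.congr' (eventually_atTop.2 ⟨j.natAbs, fun m hm => ?_⟩)
    have hab : 2 * m + c = (j + m + c).toNat + (m - j).toNat := by omega
    simp only [f, Pi.div_apply, Function.comp_apply]
    rw [if_pos (by omega), hab, gaussBinom_add_eq_div hs]
  · simp only [f]
    split_ifs
    · rw [norm_mul]
      exact mul_le_mul_of_nonneg_right (hC _ _) (norm_nonneg _)
    · rw [norm_zero]
      positivity

/-! ### Jacobi's triple product -/

lemma summable_pow_sq_mul_zpow {t z : ℝ} (ht0 : t ≠ 0) (ht : |t| < 1) (hz : z ≠ 0) :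
    Summable fun j : ℤ => t ^ (j ^ 2) * z ^ j := by
  have key : ∀ z : ℝ, z ≠ 0 → Summable fun n : ℕ => t ^ (n ^ 2) * z ^ n := by
    intro z hz
    refine summable_of_ratio_test_tendsto_lt_one zero_lt_one
      (Eventually.of_forall fun n => mul_ne_zero (pow_ne_zero _ ht0) (pow_ne_zero _ hz)) ?_
    have hr : ∀ n : ℕ, ‖t ^ ((n + 1) ^ 2) * z ^ (n + 1)‖ / ‖t ^ (n ^ 2) * z ^ n‖ =
        |t| * |z| * (|t| ^ 2) ^ n := by
      intro n
      have ht' : |t| ≠ 0 := abs_ne_zero.2 ht0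
      have hz' : |z| ≠ 0 := abs_ne_zero.2 hz
      simp only [norm_mul, norm_pow, Real.norm_eq_abs]
      rw [div_eq_iff (mul_ne_zero (pow_ne_zero _ ht') (pow_ne_zero _ hz')),
        show (n + 1) ^ 2 = n ^ 2 + 2 * n + 1 by ring, pow_succ, pow_succ, pow_add, pow_mul]
      ring
    simp only [hr]
    rw [← mul_zero (|t| * |z|)]
    refine (tendsto_pow_atTop_nhds_zero_of_lt_one (by positivity) ?_).const_mul _
    exact pow_lt_one₀ (abs_nonneg t) ht two_ne_zero
  refine Summable.of_nat_of_neg ((key z hz).congr fun n => ?_)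
    ((key z⁻¹ (inv_ne_zero hz)).congr fun n => ?_)
  · rw [← zpow_natCast, ← zpow_natCast]
    push_cast
    rfl
  · rw [neg_sq, zpow_neg, ← inv_zpow, ← zpow_natCast, ← zpow_natCast]
    push_cast
    rfl

lemma multipliable_one_add_mul_pow {t : ℝ} (ht : |t| < 1) (z : ℝ) (d : ℕ) :
    Multipliable fun l : ℕ => 1 + z * t ^ (2 * l + d) := by
  refine multipliable_one_add_of_summable ?_
  have h : ∀ l : ℕ, ‖z * t ^ (2 * l + d)‖ = |z| * |t| ^ d * (|t| ^ 2) ^ l := by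
    intro l
    rw [norm_mul, norm_pow, Real.norm_eq_abs, Real.norm_eq_abs, pow_add, pow_mul]
    ring
  simp only [h]
  exact (summable_geometric_of_lt_one (by positivity)
    (pow_lt_one₀ (abs_nonneg t) ht two_ne_zero)).mul_left _

/-- Jacobi's triple product, as the limit of its finite form. -/
lemma tsum_pow_sq_mul_zpow {t z : ℝ} (ht0 : t ≠ 0) (ht : |t| < 1) (hz : z ≠ 0) :
    ∑' j : ℤ, t ^ (j ^ 2) * z ^ j = (∏' l : ℕ, (1 + z * t ^ (2 * l + 1))) *
      (∏' l : ℕ, (1 + z⁻¹ * t ^ (2 * l + 1))) * ∏' i : ℕ, (1 - (t ^ 2) ^ (i + 1)) := by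
  have ht2 : |t ^ 2| < 1 := by
    rw [abs_pow]
    exact pow_lt_one₀ (abs_nonneg t) ht two_ne_zero
  have h1 := ((multipliable_one_add_mul_pow ht z 1).hasProd.mul
    (multipliable_one_add_mul_pow ht z⁻¹ 1).hasProd).tendsto_prod_nat
  have h2 := tendsto_sum_gaussBinom_mul ht2 (summable_pow_sq_mul_zpow ht0 ht hz) 0
  simp only [prod_one_add_mul_one_add_inv ht0 hz] at h1
  simp only [Nat.cast_zero, sub_zero, add_zero] at h2
  rw [tendsto_nhds_unique h1 h2, div_mul_cancel₀ _ (tprod_one_sub_pow_ne_zero ht2)]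

end Limits

/-! ### The limits of the normalized counts -/

section Limit

variable {q : ℕ}

lemma one_lt_of_card_eq_sq {F : Type*} [Field F] (hq : Odd q) (hF : Nat.card F = q ^ 2) :
    1 < q := by
  have := finite_of_card_eq_sq hq hF
  have h := Finite.one_lt_card (α := F)
  rw [hF] at h
  exact (Nat.one_lt_pow_iff two_ne_zero).1 h

lemma abs_neg_one_div_lt_one (hq1 : 1 < q) : |-1 / (q : ℝ)| < 1 := by
  have h : (1 : ℝ) < q := by exact_mod_cast hq1
  rw [abs_div, abs_neg, abs_one, abs_of_pos (by linarith), div_lt_one (by linarith)]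
  exact h

lemma inv_sq_bounds (hq1 : 1 < q) :
    ((q : ℝ) ^ 2)⁻¹ ≠ 0 ∧ |((q : ℝ) ^ 2)⁻¹| < 1 ∧ |((q : ℝ) ^ 2)⁻¹ ^ 2| < 1 := by
  have h : (1 : ℝ) < q := by exact_mod_cast hq1
  have ht : |((q : ℝ) ^ 2)⁻¹| < 1 := by
    rw [abs_of_pos (by positivity)]
    exact inv_lt_one_of_one_lt₀ (one_lt_pow₀ h two_ne_zero)
  refine ⟨by positivity, ht, ?_⟩
  rw [abs_pow]
  exact pow_lt_one₀ (abs_nonneg _) ht two_ne_zero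

/-- The number of Hermitian idempotents of rank `r` in dimension `n = r + k`. -/
lemma card_starProjectionsOfRank {F : Type*} [Field F] [StarRing F] (hq : Odd q)
    (hF : Nat.card F = q ^ 2) (hs : ∀ a : F, star a = a ^ q) {n r k : ℕ} (h : r + k = n) :
    (Nat.card (starProjectionsOfRank (Fin n) F r) : ℝ) =
      (q : ℝ) ^ (2 * r * k) * gaussBinom (-1 / (q : ℝ)) n r := by
  have hx := abs_neg_one_div_lt_one (one_lt_of_card_eq_sq hq hF)
  have hq0 : (q : ℝ) ≠ 0 := Nat.cast_ne_zero.2 hq.pos.ne'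
  induction r generalizing k with
  | zero =>
    rw [card_starProjectionsOfRank_zero, gaussBinom_zero_right]
    simp
  | succ r ih =>
    have h1 := ih (k := k + 1) (by omega)
    have h2 := congrArg (Int.cast : ℤ → ℝ)
      (card_starProjectionsOfRank_succ (ι := Fin n) hq hF hs r)
    rw [Fintype.card_fin, show n - r = k + 1 by omega] at h2
    push_cast at h2
    have hpow : ∀ j : ℕ, (q : ℝ) ^ j - (-1) ^ j = q ^ j * (1 - (-1 / (q : ℝ)) ^ j) := by
      intro j
      rw [div_pow]
      field_simp
    have h3 := gaussBinom_mul_eulerProd (-1 / (q : ℝ)) (r + 1) k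
    have h4 := gaussBinom_mul_eulerProd (-1 / (q : ℝ)) r (k + 1)
    rw [h] at h3
    rw [show r + (k + 1) = n by omega, ← h3, eulerProd_succ, eulerProd_succ] at h4
    have h5 : gaussBinom (-1 / (q : ℝ)) n r * (1 - (-1 / (q : ℝ)) ^ (k + 1)) =
        gaussBinom (-1 / (q : ℝ)) n (r + 1) * (1 - (-1 / (q : ℝ)) ^ (r + 1)) := by
      refine mul_right_cancel₀
        (mul_ne_zero (eulerProd_ne_zero hx r) (eulerProd_ne_zero hx k)) ?_
      linear_combination h4
    rw [hpow, hpow, h1] at h2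
    refine mul_right_cancel₀ (mul_ne_zero (pow_ne_zero (2 * (r + 1)) hq0)
      (one_sub_pow_ne_zero hx r)) ?_
    have e1 : (q : ℝ) ^ (2 * (r + 1)) = q ^ (r + 1) * q ^ (r + 1) := by rw [← pow_add, two_mul]
    have e2 : (q : ℝ) ^ (2 * (r + 1) * k) * q ^ (2 * (r + 1)) =
        q ^ (2 * r * (k + 1)) * (q ^ (k + 1) * q ^ (k + 1)) := by
      rw [← pow_add, ← pow_add, ← pow_add]
      congr 1
      ring
    calc _ = (Nat.card (starProjectionsOfRank (Fin n) F (r + 1)) : ℝ) *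
          (q ^ (r + 1) * (q ^ (r + 1) * (1 - (-1 / (q : ℝ)) ^ (r + 1)))) := by rw [e1]; ring
      _ = _ := by
        rw [h2]
        linear_combination (q : ℝ) ^ (2 * r * (k + 1)) * (q ^ (k + 1) * q ^ (k + 1)) * h5 -
          gaussBinom (-1 / (q : ℝ)) n (r + 1) * (1 - (-1 / (q : ℝ)) ^ (r + 1)) * e2

/-- For `n = 2 * m + c`, the Hermitian idempotents of rank `m + c + j` contribute
`q ^ (-2 * (j ^ 2 + c * j))` times a Gaussian binomial coefficient to the normalized count. -/
lemma unitaryInvolutionCount_div_eq_sum {F : Type*} [Field F] (hq : Odd q)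
    (hF : Nat.card F = q ^ 2) (m c : ℕ) :
    (unitaryInvolutionCount (2 * m + c) q F : ℝ) / (q : ℝ) ^ (2 * m ^ 2 + 2 * c * m) =
      ∑ k ∈ Finset.range (2 * m + c + 1), gaussBinom (-1 / (q : ℝ)) (2 * m + c) k *
        (((q : ℝ) ^ 2)⁻¹ ^ (((k : ℤ) - m - c) ^ 2) *
          (((q : ℝ) ^ 2)⁻¹ ^ c) ^ ((k : ℤ) - m - c)) := by
  obtain ⟨_, hs⟩ := exists_starRing_pow hF hq
  have hq0 : (q : ℝ) ≠ 0 := Nat.cast_ne_zero.2 hq.pos.ne'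
  rw [unitaryInvolutionCount_eq_sum hq hF hs, Nat.cast_sum, Finset.sum_div]
  refine Finset.sum_congr rfl fun k hk => ?_
  obtain ⟨b, hb⟩ := Nat.exists_eq_add_of_le (Nat.lt_succ_iff.1 (Finset.mem_range.1 hk))
  rw [card_starProjectionsOfRank hq hF hs hb.symm, mul_comm, mul_div_assoc]
  congr 1
  rw [← zpow_natCast (((q : ℝ) ^ 2)⁻¹) c, ← zpow_mul, ← zpow_add₀ (inv_ne_zero (pow_ne_zero 2 hq0)),
    inv_zpow', ← zpow_natCast (q : ℝ) 2, ← zpow_mul, ← zpow_natCast, ← zpow_natCast,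
    ← zpow_sub₀ hq0]
  congr 1
  obtain hb' : (b : ℤ) = 2 * m + c - k := by omega
  push_cast
  rw [hb']
  ring

lemma tendsto_unitaryInvolutionCount {F : Type*} [Field F] (hq : Odd q)
    (hF : Nat.card F = q ^ 2) (c : ℕ) :
    Tendsto (fun m : ℕ => (unitaryInvolutionCount (2 * m + c) q F : ℝ) /
        (q : ℝ) ^ (2 * m ^ 2 + 2 * c * m)) atTop
      (𝓝 ((∑' j : ℤ, ((q : ℝ) ^ 2)⁻¹ ^ (j ^ 2) * (((q : ℝ) ^ 2)⁻¹ ^ c) ^ j) /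
        ∏' i : ℕ, (1 - (-1 / (q : ℝ)) ^ (i + 1)))) := by
  have hq1 := one_lt_of_card_eq_sq hq hF
  obtain ⟨ht0, ht, -⟩ := inv_sq_bounds hq1
  simp only [unitaryInvolutionCount_div_eq_sum hq hF]
  exact tendsto_sum_gaussBinom_mul (abs_neg_one_div_lt_one hq1)
    (summable_pow_sq_mul_zpow ht0 ht (pow_ne_zero c ht0)) c

lemma tendsto_atTop_inf_principal_of_two_mul_add {α : Type*} {f : ℕ → α} {l : Filter α}
    {s : Set ℕ} {c : ℕ} (hs : ∀ n ∈ s, ∃ m, n = 2 * m + c)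
    (h : Tendsto (fun m => f (2 * m + c)) atTop l) : Tendsto f (atTop ⊓ 𝓟 s) l := by
  intro u hu
  obtain ⟨M, hM⟩ := mem_atTop_sets.1 (h hu)
  rw [mem_map, mem_inf_principal]
  refine mem_atTop_sets.2 ⟨2 * M + c, fun n hn hns => ?_⟩
  obtain ⟨m, rfl⟩ := hs n hns
  exact hM m (by omega)

lemma inv_sq_zpow_natCast (q n : ℕ) : ((q : ℝ) ^ 2)⁻¹ ^ n = (q : ℝ) ^ (-2 * (n : ℤ)) := by
  rw [zpow_mul, zpow_natCast, zpow_neg]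
  rfl

lemma evenFactor_succ (q k : ℕ) : evenFactor q (k + 1) =
    (1 + 1 * ((q : ℝ) ^ 2)⁻¹ ^ (2 * k + 1)) * (1 + 1 * ((q : ℝ) ^ 2)⁻¹ ^ (2 * k + 1)) *
      (1 - (((q : ℝ) ^ 2)⁻¹ ^ 2) ^ (k + 1)) / (1 - (-1 / (q : ℝ)) ^ (k + 1)) := by
  have h1 : (2 - 4 * ((k + 1 : ℕ) : ℤ)) = -2 * ((2 * k + 1 : ℕ) : ℤ) := by push_cast; ring
  have h2 : (-4 * ((k + 1 : ℕ) : ℤ)) = -2 * ((2 * (k + 1) : ℕ) : ℤ) := by push_cast; ring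
  rw [evenFactor, h1, h2, ← inv_sq_zpow_natCast, ← inv_sq_zpow_natCast, ← pow_mul, one_mul, ← sq]

lemma oddFactor_succ (q k : ℕ) : oddFactor q (k + 1) =
    (1 + 1 * ((q : ℝ) ^ 2)⁻¹ ^ (2 * k + 2)) * (1 + 1 * ((q : ℝ) ^ 2)⁻¹ ^ (2 * k + 2)) *
      (1 - (((q : ℝ) ^ 2)⁻¹ ^ 2) ^ (k + 1)) / (1 - (-1 / (q : ℝ)) ^ (k + 1)) := by
  have h : (-4 * ((k + 1 : ℕ) : ℤ)) = -2 * ((2 * k + 2 : ℕ) : ℤ) := by push_cast; ring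
  rw [oddFactor, h, ← inv_sq_zpow_natCast, ← pow_mul, one_mul, ← sq]
  rfl

/-- The triple product at `z = 1`. -/
lemma hasProd_evenFactor (hq1 : 1 < q) : HasProd (fun k : ℕ => evenFactor q (k + 1))
    ((∑' j : ℤ, ((q : ℝ) ^ 2)⁻¹ ^ (j ^ 2) * (((q : ℝ) ^ 2)⁻¹ ^ 0) ^ j) /
      ∏' i : ℕ, (1 - (-1 / (q : ℝ)) ^ (i + 1))) := by
  have hx := abs_neg_one_div_lt_one hq1
  obtain ⟨ht0, ht, ht2⟩ := inv_sq_bounds hq1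
  rw [pow_zero, tsum_pow_sq_mul_zpow ht0 ht one_ne_zero, inv_one]
  exact ((((multipliable_one_add_mul_pow ht 1 1).hasProd.mul
    (multipliable_one_add_mul_pow ht 1 1).hasProd).mul
      (multipliable_one_sub_pow ht2).hasProd).div₀ (multipliable_one_sub_pow hx).hasProd
        (tprod_one_sub_pow_ne_zero hx)).congr_fun (evenFactor_succ q)

/-- Here the triple product is taken at `z = t`; the factor `1 + z⁻¹ * t = 2` of index zero makes
the sum twice the product. -/
lemma hasProd_oddFactor (hq1 : 1 < q) : HasProd (fun k : ℕ => oddFactor q (k + 1))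
    ((∑' j : ℤ, ((q : ℝ) ^ 2)⁻¹ ^ (j ^ 2) * (((q : ℝ) ^ 2)⁻¹ ^ 1) ^ j) /
      (∏' i : ℕ, (1 - (-1 / (q : ℝ)) ^ (i + 1))) / 2) := by
  have hx := abs_neg_one_div_lt_one hq1
  obtain ⟨ht0, ht, ht2⟩ := inv_sq_bounds hq1
  have h := (((multipliable_one_add_mul_pow ht 1 2).hasProd.mul
    (multipliable_one_add_mul_pow ht 1 2).hasProd).mul
      (multipliable_one_sub_pow ht2).hasProd).div₀ (multipliable_one_sub_pow hx).hasProd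
        (tprod_one_sub_pow_ne_zero hx)
  rw [pow_one, tsum_pow_sq_mul_zpow ht0 ht ht0]
  set t : ℝ := ((q : ℝ) ^ 2)⁻¹ with htdef
  have h1 : ∏' l : ℕ, (1 + t * t ^ (2 * l + 1)) = ∏' l : ℕ, (1 + 1 * t ^ (2 * l + 2)) :=
    tprod_congr fun l => by ring
  have h2 : ∏' l : ℕ, (1 + t⁻¹ * t ^ (2 * l + 1)) = 2 * ∏' l : ℕ, (1 + 1 * t ^ (2 * l + 2)) := by
    have h3 : ∀ l : ℕ, 1 + t⁻¹ * t ^ (2 * (l + 1) + 1) = 1 + 1 * t ^ (2 * l + 2) := by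
      intro l
      rw [pow_succ', inv_mul_cancel_left₀ ht0, one_mul, mul_add, mul_one]
    have h5 := multipliable_one_add_mul_pow ht 1 2
    simp only [← h3] at h5
    rw [tprod_eq_zero_mul' (f := fun l : ℕ => 1 + t⁻¹ * t ^ (2 * l + 1)) h5, tprod_congr h3,
      mul_zero, zero_add, pow_one, inv_mul_cancel₀ ht0, one_add_one_eq_two]
  have h4 : ∀ a b c : ℝ, a * (2 * a) * b / c / 2 = a * a * b / c := fun a b c => by ring
  rw [h1, h2, h4]
  exact h.congr_fun (oddFactor_succ q)

end Limit

theorem mainTheorem4 (q : ℕ) (hq : Odd q) (F : Type*) [Field F] (hF : Nat.card F = q ^ 2) :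
    (Multipliable (fun k : ℕ => evenFactor q (k + 1)) ∧
      Tendsto (fun n : ℕ => (unitaryInvolutionCount n q F : ℝ) / (q : ℝ) ^ (n ^ 2 / 2))
        (atTop ⊓ 𝓟 {n : ℕ | Even n})
        (𝓝 (∏' k : ℕ, evenFactor q (k + 1)))) ∧
    (Multipliable (fun k : ℕ => oddFactor q (k + 1)) ∧
      Tendsto (fun n : ℕ => (unitaryInvolutionCount n q F : ℝ) / (q : ℝ) ^ ((n ^ 2 - 1) / 2))
        (atTop ⊓ 𝓟 {n : ℕ | Odd n})
        (𝓝 (2 * ∏' k : ℕ, oddFactor q (k + 1)))) := by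
  have hq1 := one_lt_of_card_eq_sq hq hF
  have he := hasProd_evenFactor hq1
  have ho := hasProd_oddFactor hq1
  refine ⟨⟨he.multipliable, ?_⟩, ⟨ho.multipliable, ?_⟩⟩
  · refine tendsto_atTop_inf_principal_of_two_mul_add (c := 0)
      (fun n hn => even_iff_exists_two_mul.1 hn) ?_
    rw [he.tprod_eq]
    refine (tendsto_unitaryInvolutionCount hq hF 0).congr fun m => ?_
    rw [show (2 * m + 0) ^ 2 / 2 = 2 * m ^ 2 + 2 * 0 * m by
      rw [show (2 * m + 0) ^ 2 = 2 * (2 * m ^ 2 + 2 * 0 * m) by ring,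
        Nat.mul_div_cancel_left _ two_pos]]
  · refine tendsto_atTop_inf_principal_of_two_mul_add (c := 1) (fun n hn => hn) ?_
    rw [ho.tprod_eq, mul_div_cancel₀ _ two_ne_zero]
    refine (tendsto_unitaryInvolutionCount hq hF 1).congr fun m => ?_
    rw [show ((2 * m + 1) ^ 2 - 1) / 2 = 2 * m ^ 2 + 2 * 1 * m by
      rw [show (2 * m + 1) ^ 2 = 2 * (2 * m ^ 2 + 2 * 1 * m) + 1 by ring, Nat.add_sub_cancel,
        Nat.mul_div_cancel_left _ two_pos]]
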